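/- **Conventions.** $\lambda\in\mathbb N$ is the security parameter, $n=n(\lambda)$ the (polynomially bounded) number of applicants. A function $\nu:\mathbb N\to\mathbb R$ is negligible if $\lambda^c\nu(\lambda)\to0$ for every $c$. A QPT adversary is non-uniform: for every $\lambda$ it consists of polynomial-size quantum circuits (gates $H,T,\mathrm{CNOT}$ and fresh $|0\rangle$ qubits), one per stage, together with a quantum advice state on polynomially many qubits; its messages are obtained by measuring, and the unmeasured qubits are handed to the next stage as internal state. PPT means a polynomial-time Turing machine with polynomially many uniform coins. **Families.** A family $f_k:\mathcal X_\lambda\to\mathcal Y_\lambda$, $k\in\mathcal K_\lambda$, with $\mathcal X_\lambda\subseteq\{0,1\}^{l}$ and with keys, images and trapdoors ($\mathcal T_\lambda$) being bit strings of polynomial length, is *$\delta$-HGHZ capable*, with key generation $\mathtt{Gen}$, a map $h$ from $\mathcal X_\lambda$ to $\{0,1\}^n$ (possibly depending on $k$) and strings $\mathbf d_0(k)\in\{0,1\}^n$, if: - $\mathtt{Gen}(1^\lambda,\mathbf d_0)$ is PPT and outputs $(k,t_k)\in\mathcal K_\lambda\times\mathcal T_\lambda$ with probability $1-\mathrm{negl}(\lambda)$;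 below, $t_k$ denotes any trapdoor in $\mathcal T_\lambda$ that $\mathtt{Gen}$ can output with $k\in\mathcal K_\lambda$; - $f_k$ is computable in PPT; a PPT algorithm $\mathtt{Invert}(t_k,y)$, for $y\in\mathcal Y_\lambda$, outputs the two preimages of $y$ if $|f_k^{-1}(y)|=2$, and $\bot$ otherwise; a PPT algorithm computes $\mathbf d_0(k)$ from $t_k$; - a uniform QPT algorithm prepares the uniform superposition over $\mathcal X_\lambda$ (up to negligible error); - for all $k\in\mathcal K_\lambda$ and uniform $x\in\mathcal X_\lambda$, $|f_k^{-1}(f_k(x))|=2$ with probability at least $1-\delta(\lambda)$; - for $k\in\mathcal K_\lambda$, if $f_k^{-1}(y)=\{x,x'\}$ with $x\ne x'$, then $h(x)\oplus h(x')=\mathbf d_0(k)$; and $\mathbf d_0(k)=\mathbf d_0^*$ whenever $k\in\mathcal K_\lambda$ is output by $\mathtt{Gen}(1^\lambda,\mathbf d_0^*)$; - IND-D0: every QPT adversary that chooses $\mathbf d_0^{(0)},\mathbf d_0^{(1)}$ and receives the key $k$ of $(k,t_k)\gets\mathtt{Gen}(1^\lambda,\mathbf d_0^{(c)})$, for a uniform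 bit $c$, guesses $c$ with probability at most $\frac12+\mathrm{negl}(\lambda)$. It is *$\delta$-GHZ$_{can}$ capable*, with a PPT algorithm $\mathtt{PartInfo}(t,y)$ with outputs $v\in\{0,1,\times,\bot\}^n$, if moreover, for all $t_k$ as above, $y\in\mathcal Y_\lambda$ and every possible output $v$ of $\mathtt{PartInfo}(t_k,y)$: $|f_k^{-1}(y)|=2$ iff $\bot\notin v$; $v[i]\in\{0,1\}$ implies $\mathbf d_0(k)[i]=1$ and $v[i]=\times$ implies $\mathbf d_0(k)[i]=0$; if $f_k^{-1}(y)=\{x,x'\}$ has two elements, there is $u\in\{h(x),h(x')\}$ with $v[i]=u[i]$ for all $i$ with $\mathbf d_0(k)[i]=1$; and every QPT adversary $(\mathcal A_1,\mathcal A_2,\mathcal A_3)$ wins the following game IND-PARTIAL with probability at most $\frac12+\mathrm{negl}(\lambda)$: 1. $(\mathcal M,\mathbf d_0^{(0)},\mathbf d_0^{(1)})\gets\mathcal A_1(1^\lambda)$ with $\mathcal M\subseteq\{1,\dots,n\}$; the adversary loses if $\mathbf d_0^{(0)}[i]\neq\mathbf d_0^{(1)}[i]$ for some $i\in\mathcal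 M$; 2. $c$ is a uniform bit, $(k,t_k)\gets\mathtt{Gen}(1^\lambda,\mathbf d_0^{(c)})$, $y\gets\mathcal A_2(k)$, $v\gets\mathtt{PartInfo}(t_k,y)$; 3. $\tilde c\gets\mathcal A_3(\{(i,v[i])\}_{i\in\mathcal M})$; the adversary wins iff $\tilde c=c$. **The game IND-BLIND$^{sup}_{can}$** (the adversary controls the server and the applicants in $\mathcal M$, and Cupid follows the protocol BLIND$^{sup}_{can}$): 1. $(\mathcal M,\mathbf d_0^{(0)},\mathbf d_0^{(1)})\gets\mathcal A_1(1^\lambda)$; the adversary loses if $\mathbf d_0^{(0)}[i]\neq\mathbf d_0^{(1)}[i]$ for some $i\in\mathcal M$; 2. it also loses if some $i\in\mathcal M$ has $\mathbf d_0^{(0)}[i]=1$ and, in addition, $\mathbf d_0^{(0)}[i]=0$ for all $i\notin\mathcal M$ or $\mathbf d_0^{(1)}[i]=0$ for all $i\notin\mathcal M$ (so either some supported applicant is honest or no supported applicant is corrupted); 3. $c$ is a uniform bit, $(k,t_k)\gets\mathtt{Gen}(1^\lambda,\mathbf d_0^{(c)})$, $(y,b)\gets\mathcal A_2(k)$ with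 $b\in\{0,1\}^l$, $v\gets\mathtt{PartInfo}(t_k,y)$; 4. if $\bot\notin v$ and $f_k^{-1}(y)=\{x,x'\}$ with $x\neq x'$, then $\alpha:=\langle b,x\oplus x'\rangle$, otherwise $\alpha$ is a uniform bit; 5. with $\mathcal S=\{i:\mathbf d_0^{(c)}[i]=1\}$, $\hat\alpha$ is uniform among the strings in $\{0,1\}^n$ with $\bigoplus_{i\in\mathcal S}\hat\alpha_i=\alpha$ (among all strings if $\mathcal S=\emptyset$); 6. $\tilde c\gets\mathcal A_3(\{(i,\hat\alpha_i,v[i])\}_{i\in\mathcal M})$; the adversary wins iff $\tilde c=c$. **Lemma (Security of BLIND$^{sup}_{can}$).** Let $\{f_k\}$, with $\mathtt{Gen}$ and $\mathtt{PartInfo}$, be a $\delta$-GHZ$_{can}$ capable family with $\delta$ negligible. Then for every QPT adversary $\mathcal A=(\mathcal A_1,\mathcal A_2,\mathcal A_3)$ there is a negligible function $\nu$ such that, for all $\lambda$, $$\Pr\left[\text{IND-BLIND}^{sup}_{can}{}^{\mathcal A}(\lambda)\right]\le\tfrac12+\nu(\lambda).$$ -/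

import Mathlib

namespace BlindGHZ

open scoped Matrix ComplexOrder

/-! ### Bit strings, negligible functions, polynomial bounds -/

/-- Bit strings of length `m`. -/
abbrev Bits (m : ℕ) : Type := Fin m → Bool

/-- A function of the security parameter that tends to `0` faster than any inverse polynomial. -/
def Negligible (ν : ℕ → ℝ) : Prop :=
  Asymptotics.SuperpolynomialDecay Filter.atTop (fun s : ℕ => (s : ℝ)) ν

/-- A function of the security parameter that is bounded by a polynomial. -/
def PolyBounded (g : ℕ → ℕ) : Prop := ∃ p : Polynomial ℕ, ∀ s, g s ≤ p.eval s

/-- The exclusive or of the bits `r i`, `i ∈ S`. -/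
def xorOver {m : ℕ} (S : Finset (Fin m)) (r : Bits m) : Bool :=
  decide (Odd (S.filter fun i => r i = true).card)

/-- The inner product `⟨b, x⟩ = ⨁ i, b i * x i`. -/
def innerBit {m : ℕ} (b x : Bits m) : Bool := xorOver Finset.univ fun i => b i && x i

/-- The bitwise exclusive or. -/
def bxor {m : ℕ} (x y : Bits m) : Bits m := fun i => xor (x i) (y i)

/-- The expectation of `g` under a distribution on a finite type. -/
noncomputable def expect {α : Type} [Fintype α] (μ : PMF α) (g : α → ℝ) : ℝ :=
  ∑ a, (μ a).toReal * g a

/-! ### Classical probabilistic polynomial time -/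

/-- The alphabet of classical algorithms: two bits and a separator (`none`). -/
abbrev Sym : Type := Option Bool

/-- A bit string as a word. -/
def word {m : ℕ} (x : Bits m) : List Sym := (List.ofFn x).map some

/-- A pair of bit strings as a word. -/
def pairWord {m m' : ℕ} (x : Bits m × Bits m') : List Sym := word x.1 ++ none :: word x.2

/-- The unary word `1^s`. -/
def unary (s : ℕ) : List Sym := List.replicate s (some true)

/-- A function on words that some Turing machine computes in polynomial time. -/
def PolyTime {Γ Γ' : Type} (D : List Γ → List Γ') : Prop :=
  Nonempty (Turing.TM2ComputableInPolyTime (id : List Γ → List Γ) (id : List Γ' → List Γ') D)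

/-- `R s a` is the output distribution of a `PPT` algorithm on input `(1^s, a)`: a deterministic
polynomial-time machine is run on the input together with polynomially many uniform coins. The maps
`ea` and `eb` write inputs and outputs as words. -/
def IsPPT {α β : ℕ → Type} (ea : ∀ s, α s → List Sym) (eb : ∀ s, β s → List Sym)
    (R : ∀ s, α s → PMF (β s)) : Prop :=
  ∃ (p : Polynomial ℕ) (D : List Sym → List Sym), PolyTime D ∧
    ∀ s a, (R s a).map (eb s) =
      (PMF.uniformOfFintype (Bits (p.eval s))).map
        fun r => D (unary s ++ none :: (ea s a ++ none :: word r))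

/-! ### Quantum circuits -/

/-- Gates of the universal gate set `{H, T, CNOT}` on the wires `W`. -/
inductive Gate (W : Type) : Type
  | had (i : W)
  | phase (i : W)
  | cnot (i j : W) (hij : i ≠ j)

/-- The unitary matrix of a gate in the computational basis `W → Bool`: `had i` is the Hadamard
gate on wire `i`, `phase i` is the gate `diag (1, exp (iπ/4))` on wire `i`, and `cnot i j` adds the
control wire `i` to the target wire `j`. -/
noncomputable def Gate.mat {W : Type} [Fintype W] [DecidableEq W] :
    Gate W → Matrix (W → Bool) (W → Bool) ℂ
  | .had i => Matrix.of fun x y =>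
      if ∀ j, j ≠ i → x j = y j then
        (if (x i && y i) = true then -1 else 1) / (Real.sqrt 2 : ℂ) else 0
  | .phase i => Matrix.diagonal fun x =>
      if x i = true then Complex.exp (Complex.I * Real.pi / 4) else 1
  | .cnot i j _ => Matrix.of fun x y =>
      if x = Function.update y j (xor (y j) (y i)) then 1 else 0

/-- A circuit; the head of the list is applied first. -/
abbrev Circuit (W : Type) : Type := List (Gate W)

/-- The unitary matrix of a circuit. -/
noncomputable def Circuit.mat {W : Type} [Fintype W] [DecidableEq W] (C : Circuit W) :
    Matrix (W → Bool) (W → Bool) ℂ :=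
  C.foldl (fun U g => g.mat * U) 1

/-! ### Uniform quantum polynomial time, for preparing a state -/

/-- The alphabet of circuit descriptions. -/
inductive GateSym : Type
  | had | phase | cnot | tick | sep

/-- The description of a gate, wire numbers being written in unary. -/
def Gate.descr {N : ℕ} : Gate (Fin N) → List GateSym
  | .had i => GateSym.had :: List.replicate i GateSym.tick
  | .phase i => GateSym.phase :: List.replicate i GateSym.tick
  | .cnot i j _ => GateSym.cnot ::
      (List.replicate i GateSym.tick ++ GateSym.sep :: List.replicate j GateSym.tick)

/-- The amplitudes of the uniform superposition of the elements of `X`. -/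
noncomputable def uniformAmp {m : ℕ} (X : Finset (Bits m)) (x : Bits m) : ℂ :=
  if x ∈ X then ((Real.sqrt X.card)⁻¹ : ℂ) else 0

/-- A uniform `QPT` algorithm prepares, on input `1^s`, the uniform superposition over `X s`: a
polynomial-time machine writes, on input `1^s`, a circuit on `l s + w s` wires which maps `|0…0⟩`,
up to negligible error in squared norm, to a product of this superposition on the first `l s` wires
and some state `g s` of the `w s` work wires. -/
def CanPrepareUniform (l : ℕ → ℕ) (X : ∀ s, Finset (Bits (l s))) : Prop :=
  ∃ (w : ℕ → ℕ) (C : ∀ s, Circuit (Fin (l s + w s))) (D : List Sym → List GateSym)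
    (g : ∀ s, Bits (w s) → ℂ) (ν : ℕ → ℝ),
    PolyBounded w ∧ PolyTime D ∧ (∀ s, D (unary s) = (C s).flatMap Gate.descr) ∧
    Negligible ν ∧
    ∀ s, ∑ x : Bits (l s), ∑ z : Bits (w s),
      ‖(C s).mat (Fin.append x z) (fun _ => false) - uniformAmp (X s) x * g s z‖ ^ 2 ≤ ν s

/-! ### Interactive quantum adversaries

Classical messages are written on wires. An adversary that sends and receives several messages is
split into stages, each passing its internal quantum state to the next one. -/

/-- Operators on `q` qubits. -/
abbrev Op (q : ℕ) : Type := Matrix (Bits q) (Bits q) ℂ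

/-- One stage of an adversary: from an internal state of `q` qubits, a classical message on the
wires `I` and `anc` fresh qubits in the state `|0⟩`, a circuit is applied, and the wires are then
split into those that are measured in the computational basis, giving the classical message on the
wires `O`, and the `q'` qubits that form the new internal state. -/
structure Stage (q : ℕ) (I O : Type) (q' : ℕ) where
  anc : ℕ
  circ : Circuit (Fin q ⊕ I ⊕ Fin anc)
  out : (Fin q ⊕ I ⊕ Fin anc) ≃ (O ⊕ Fin q')

/-- The number of gates and of fresh qubits of a stage. -/
def Stage.size {q q' : ℕ} {I O : Type} (S : Stage q I O q') : ℕ := S.anc + S.circ.length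

/-- The state `ρ ⊗ |m⟩⟨m| ⊗ |0…0⟩⟨0…0|` in which a stage starts. -/
noncomputable def Stage.init {q q' : ℕ} {I O : Type} [Fintype I]
    (S : Stage q I O q') (ρ : Op q) (m : I → Bool) :
    Matrix (Fin q ⊕ I ⊕ Fin S.anc → Bool) (Fin q ⊕ I ⊕ Fin S.anc → Bool) ℂ :=
  Matrix.of fun x y =>
    if (∀ i, x (.inr (.inl i)) = m i) ∧ (∀ i, y (.inr (.inl i)) = m i) ∧
        (∀ a, x (.inr (.inr a)) = false) ∧ (∀ a, y (.inr (.inr a)) = false) then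
      ρ (fun j => x (.inl j)) (fun j => y (.inl j)) else 0

/-- The unnormalized internal state after a stage that was started with internal state `ρ` and
incoming message `m` and in which the outgoing message was measured to be `o`; its trace is the
trace of `ρ` times the probability of `o`. -/
noncomputable def Stage.run {q q' : ℕ} {I O : Type} [Fintype I] [DecidableEq I]
    (S : Stage q I O q') (ρ : Op q) (m : I → Bool) (o : O → Bool) : Op q' :=
  (S.circ.mat * S.init ρ m * (S.circ.mat)ᴴ).submatrix
    (fun z w => Sum.elim o z (S.out w)) (fun z w => Sum.elim o z (S.out w))

/-- The trace of an operator, as a real number. -/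
noncomputable def weight {q : ℕ} (ρ : Op q) : ℝ := (Matrix.trace ρ).re

/-- An adversary with two stages: it starts from a quantum advice state, sends a message on `O₁`,
receives one on `I₂`, and outputs a bit. -/
structure Adversary₂ (O₁ I₂ : Type) where
  (q₀ q₁ q₂ : ℕ)
  advice : Op q₀
  advice_pos : advice.PosSemidef
  advice_trace : advice.trace = 1
  A₁ : Stage q₀ Empty O₁ q₁
  A₂ : Stage q₁ I₂ Unit q₂

/-- An adversary with three stages: it starts from a quantum advice state, sends a message on `O₁`,
receives one on `I₂`, sends one on `O₂`, receives one on `I₃`, and outputs a bit. -/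
structure Adversary₃ (O₁ I₂ O₂ I₃ : Type) where
  (q₀ q₁ q₂ q₃ : ℕ)
  advice : Op q₀
  advice_pos : advice.PosSemidef
  advice_trace : advice.trace = 1
  A₁ : Stage q₀ Empty O₁ q₁
  A₂ : Stage q₁ I₂ O₂ q₂
  A₃ : Stage q₂ I₃ Unit q₃

/-- The size of an adversary: number of advice qubits, fresh qubits and gates. -/
def Adversary₂.size {O₁ I₂ : Type} (A : Adversary₂ O₁ I₂) : ℕ := A.q₀ + A.A₁.size + A.A₂.size

/-- The size of an adversary: number of advice qubits, fresh qubits and gates. -/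
def Adversary₃.size {O₁ I₂ O₂ I₃ : Type} (A : Adversary₃ O₁ I₂ O₂ I₃) : ℕ :=
  A.q₀ + A.A₁.size + A.A₂.size + A.A₃.size

/-- The empty message, sent to the first stage. -/
def noMsg : Empty → Bool := fun e => e.elim

/-! ### Families of functions and their keys -/

/-- A family of functions `f_k : X → Y`, `k ∈ K`, with its key generation `Gen`, its map `h` (which
may depend on `k`), and the bit string `d₀(k)`, for every value `s` of the security parameter. The
sets `X, Y, K` and the set `T` of trapdoors consist of bit strings whose length depends on `s`, and
`n s` is the number of applicants. -/
structure Family where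
  (n lX lY lK lT : ℕ → ℕ)
  X : ∀ s, Finset (Bits (lX s))
  Y : ∀ s, Set (Bits (lY s))
  K : ∀ s, Set (Bits (lK s))
  T : ∀ s, Set (Bits (lT s))
  f : ∀ s, Bits (lK s) → Bits (lX s) → Bits (lY s)
  h : ∀ s, Bits (lK s) → Bits (lX s) → Bits (n s)
  d₀ : ∀ s, Bits (lK s) → Bits (n s)
  Gen : ∀ s, Bits (n s) → PMF (Bits (lK s) × Bits (lT s))

namespace Family

variable (F : Family)

/-- The preimages of `y` under `f_k`. -/
def preimages (s : ℕ) (k : Bits (F.lK s)) (y : Bits (F.lY s)) : Finset (Bits (F.lX s)) :=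
  (F.X s).filter fun x => F.f s k x = y

/-- `k` is a key and `t` is a trapdoor, generated together by `Gen`. -/
def IsKeyPair (s : ℕ) (k : Bits (F.lK s)) (t : Bits (F.lT s)) : Prop :=
  k ∈ F.K s ∧ t ∈ F.T s ∧ ∃ d, (k, t) ∈ (F.Gen s d).support

end Family

/-- The probability that an adversary wins the game `IND-D0`: it sends `(d⁽⁰⁾, d⁽¹⁾)`, receives a
key generated for `d⁽ᶜ⁾` with `c` uniform, and has to guess `c`. -/
noncomputable def winIndD0 (F : Family) (s : ℕ)
    (A : Adversary₂ (Bool × Fin (F.n s)) (Fin (F.lK s))) : ℝ :=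
  ∑ d : Bool × Fin (F.n s) → Bool,
    expect (PMF.uniformOfFintype Bool) fun c =>
    expect (F.Gen s fun i => d (c, i)) fun kt =>
      weight (A.A₂.run (A.A₁.run A.advice noMsg d) kt.1 fun _ => c)

/-- An answer of `Invert`, as a word: nothing (for `⊥`) or a pair of bit strings. -/
def invertWord {m : ℕ} : Option (Bits m × Bits m) → List Sym
  | none => []
  | some x => pairWord x

/-- The `δ`-hidden-GHZ capable families. -/
structure IsHGHZCapable (F : Family) (δ : ℕ → ℝ) : Prop where
  /-- All objects have a description of polynomial length. -/
  poly_n : PolyBounded F.n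
  poly_X : PolyBounded F.lX
  poly_Y : PolyBounded F.lY
  poly_K : PolyBounded F.lK
  poly_T : PolyBounded F.lT
  /-- The functions `f_k` map `X` to `Y`. -/
  maps : ∀ s, ∀ k ∈ F.K s, ∀ x ∈ F.X s, F.f s k x ∈ F.Y s
  /-- Efficient generation. -/
  gen_ppt : IsPPT (fun _ => word) (fun _ => pairWord) F.Gen
  gen_mem : ∃ ν, Negligible ν ∧ ∀ s d,
    1 - ν s ≤ ((F.Gen s d).toOuterMeasure {kt | kt.1 ∈ F.K s ∧ kt.2 ∈ F.T s}).toReal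
  /-- Efficient computation. -/
  eval_ppt : ∃ Eval : ∀ s, Bits (F.lK s) × Bits (F.lX s) → PMF (Bits (F.lY s)),
    IsPPT (fun _ => pairWord) (fun _ => word) Eval ∧
    ∀ s, ∀ k ∈ F.K s, ∀ x ∈ F.X s, Eval s (k, x) = PMF.pure (F.f s k x)
  /-- Trapdoor: `Invert` finds both preimages if there are exactly two, and fails otherwise. -/
  invert : ∃ Invert : ∀ s, Bits (F.lT s) × Bits (F.lY s) →
      PMF (Option (Bits (F.lX s) × Bits (F.lX s))),
    IsPPT (fun _ => pairWord) (fun _ => invertWord) Invert ∧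
    ∀ s k t, F.IsKeyPair s k t → ∀ y ∈ F.Y s, ∀ o ∈ (Invert s (t, y)).support,
      ((F.preimages s k y).card = 2 → ∃ x x', o = some (x, x') ∧ F.preimages s k y = {x, x'}) ∧
      ((F.preimages s k y).card ≠ 2 → o = none)
  /-- Quantum input superposition. -/
  superposition : CanPrepareUniform F.lX F.X
  /-- `δ`-2-to-1: the image of a uniform `x ∈ X` has two preimages with probability `≥ 1 - δ`. -/
  two_to_one : ∀ s, ∀ k ∈ F.K s,
    (1 - δ s) * (F.X s).card ≤
      ((F.X s).filter fun x => (F.preimages s k (F.f s k x)).card = 2).card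
  /-- XOR of `h`. -/
  xor_h : ∀ s, ∀ k ∈ F.K s, ∀ y ∈ F.Y s, ∀ x x', x ≠ x' → F.preimages s k y = {x, x'} →
    bxor (F.h s k x) (F.h s k x') = F.d₀ s k
  d₀_gen : ∀ s d k t, (k, t) ∈ (F.Gen s d).support → k ∈ F.K s → F.d₀ s k = d
  /-- The string `d₀` is easy to obtain from the trapdoor. -/
  d₀_ppt : ∃ E : ∀ s, Bits (F.lT s) → PMF (Bits (F.n s)),
    IsPPT (fun _ => word) (fun _ => word) E ∧
    ∀ s k t, F.IsKeyPair s k t → E s t = PMF.pure (F.d₀ s k)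
  /-- Indistinguishability. -/
  ind_d0 : ∀ A : ∀ s, Adversary₂ (Bool × Fin (F.n s)) (Fin (F.lK s)),
    PolyBounded (fun s => (A s).size) →
    ∃ ν, Negligible ν ∧ ∀ s, winIndD0 F s (A s) ≤ 1 / 2 + ν s

/-! ### Partial information -/

/-- The entries of the output of `PartInfo`: a correction bit, `cross` (not supported), or `abort`
(local abort, `⊥`). -/
inductive Info : Type
  | bit (b : Bool)
  | cross
  | abort
  deriving DecidableEq, Fintype

/-- The encoding of an entry by two bits. -/
def Info.code : Info → Bool × Bool
  | .bit b => (true, b)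
  | .cross => (false, true)
  | .abort => (false, false)

/-- A list of entries, as a word. -/
def infoWord {m : ℕ} (v : Fin m → Info) : List Sym :=
  (List.ofFn v).flatMap fun e => [some e.code.1, some e.code.2]

/-- The type of the algorithm `PartInfo`, which gets a trapdoor and an image. -/
abbrev Family.PartInfoAlg (F : Family) : Type :=
  ∀ s, Bits (F.lT s) × Bits (F.lY s) → PMF (Fin (F.n s) → Info)

/-- The wires of the first message `(M, d⁽⁰⁾, d⁽¹⁾)`: `M` as a set of applicants on the left, the
bits `d⁽ᶜ⁾[i]` on the right. -/
abbrev Challenge (n : ℕ) : Type := Fin n ⊕ Bool × Fin n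

/-- The set `M` of corrupted applicants. -/
def corrupted {n : ℕ} (o : Challenge n → Bool) : Finset (Fin n) :=
  Finset.univ.filter fun i => o (.inl i) = true

/-- The support `d⁽ᶜ⁾`. -/
def support {n : ℕ} (o : Challenge n → Bool) (c : Bool) : Bits n := fun i => o (.inr (c, i))

/-- The message `{(i, v[i])}_{i ∈ M}`: for every `i`, one bit tells whether `i ∈ M`, and two bits
encode `v[i]`; the latter are blanked if `i ∉ M`. -/
def partialMsg {n : ℕ} (M : Finset (Fin n)) (v : Fin n → Info) : Fin n × Fin 3 → Bool :=
  fun w => decide (w.1 ∈ M) && ![true, (v w.1).code.1, (v w.1).code.2] w.2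

/-- The message `{(i, α̂ᵢ, v[i])}_{i ∈ M}`: for every `i`, one bit tells whether `i ∈ M`, two bits
encode `v[i]` and one is `α̂ᵢ`; the last three are blanked if `i ∉ M`. -/
def canMsg {n : ℕ} (M : Finset (Fin n)) (α : Bits n) (v : Fin n → Info) :
    Fin n × Fin 4 → Bool :=
  fun w => decide (w.1 ∈ M) && ![true, (v w.1).code.1, (v w.1).code.2, α w.1] w.2

/-- Some corrupted applicant is supported in one of `d⁽⁰⁾`, `d⁽¹⁾` and not in the other. -/
def Differs {n : ℕ} (o : Challenge n → Bool) : Prop :=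
  ∃ i ∈ corrupted o, support o false i ≠ support o true i

/-- Some supported applicant is corrupted, and no supported applicant is honest (for `d⁽⁰⁾` or for
`d⁽¹⁾`). -/
def NoHonestSupported {n : ℕ} (o : Challenge n → Bool) : Prop :=
  (∃ i ∈ corrupted o, support o false i = true) ∧
    ((∀ i ∉ corrupted o, support o false i = false) ∨
      (∀ i ∉ corrupted o, support o true i = false))

/-- Adversaries `(A₁, A₂, A₃)` in the game `IND-PARTIAL`; the second message is `y`. -/
abbrev PartialAdversary (F : Family) (s : ℕ) : Type :=
  Adversary₃ (Challenge (F.n s)) (Fin (F.lK s)) (Fin (F.lY s)) (Fin (F.n s) × Fin 3)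

open Classical in
/-- The probability that an adversary wins the game `IND-PARTIAL`. -/
noncomputable def winIndPartial (F : Family) (PartInfo : F.PartInfoAlg) (s : ℕ)
    (A : PartialAdversary F s) : ℝ :=
  ∑ o : Challenge (F.n s) → Bool,
    if Differs o then 0 else
    expect (PMF.uniformOfFintype Bool) fun c =>
    expect (F.Gen s (support o c)) fun kt =>
    ∑ y : Bits (F.lY s),
    expect (PartInfo s (kt.2, y)) fun v =>
      weight (A.A₃.run (A.A₂.run (A.A₁.run A.advice noMsg o) kt.1 y)
        (partialMsg (corrupted o) v) fun _ => c)

/-- The `δ`-GHZ-can capable families, with the algorithm `PartInfo`. -/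
structure IsGHZCanCapable (F : Family) (PartInfo : F.PartInfoAlg) (δ : ℕ → ℝ) : Prop
    extends IsHGHZCapable F δ where
  partInfo_ppt : IsPPT (fun _ => pairWord) (fun _ => infoWord) PartInfo
  /-- There is no local abort if and only if `y` has exactly two preimages. -/
  no_abort : ∀ s k t, F.IsKeyPair s k t → ∀ y ∈ F.Y s, ∀ v ∈ (PartInfo s (t, y)).support,
    (F.preimages s k y).card = 2 ↔ ∀ i, v i ≠ Info.abort
  /-- Bits are sent only to supported applicants, crosses only to the other ones. -/
  status : ∀ s k t, F.IsKeyPair s k t → ∀ y ∈ F.Y s, ∀ v ∈ (PartInfo s (t, y)).support,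
    ∀ i, (∀ b, v i = Info.bit b → F.d₀ s k i = true) ∧
      (v i = Info.cross → F.d₀ s k i = false)
  /-- The bits sent to supported applicants are those of `h` at one of the two preimages. -/
  correction : ∀ s k t, F.IsKeyPair s k t → ∀ y ∈ F.Y s, ∀ v ∈ (PartInfo s (t, y)).support,
    (F.preimages s k y).card = 2 →
      ∃ x ∈ F.preimages s k y, ∀ i, F.d₀ s k i = true → v i = Info.bit (F.h s k x i)
  /-- Indistinguishability with partial knowledge. -/
  ind_partial : ∀ A : ∀ s, PartialAdversary F s,
    PolyBounded (fun s => (A s).size) →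
    ∃ ν, Negligible ν ∧ ∀ s, winIndPartial F PartInfo s (A s) ≤ 1 / 2 + ν s

/-! ### The game for the protocol with known support status and canonical states -/

open Classical in
/-- The distribution of the phase `α` computed by Cupid: `⟨b, x ⊕ x'⟩` if there is no local abort
and `x, x'` are the two preimages of `y`, and a uniform bit otherwise. -/
noncomputable def phaseDist (F : Family) (s : ℕ) (k : Bits (F.lK s)) (y : Bits (F.lY s))
    (b : Bits (F.lX s)) (v : Fin (F.n s) → Info) : PMF Bool :=
  if H : (∀ i, v i ≠ Info.abort) ∧ ∃ p : Bits (F.lX s) × Bits (F.lX s),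
      p.1 ≠ p.2 ∧ F.preimages s k y = {p.1, p.2} then
    PMF.pure (innerBit b (bxor H.2.choose.1 H.2.choose.2))
  else PMF.uniformOfFintype Bool

/-- The possible shares `α̂` of `α` among the applicants supported in `d`: the bits `α̂ᵢ` of the
supported applicants add up to `α`, unless nobody is supported. -/
def shares {n : ℕ} (d : Bits n) (α : Bool) : Finset (Bits n) :=
  Finset.univ.filter fun r =>
    xorOver (Finset.univ.filter fun i => d i = true) r = α ∨
      (Finset.univ.filter fun i => d i = true) = ∅

theorem shares_nonempty {n : ℕ} (d : Bits n) (α : Bool) : (shares d α).Nonempty := by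
  by_cases hd : (Finset.univ.filter fun i => d i = true) = ∅
  · exact ⟨fun _ => false, by simp [shares, hd]⟩
  · obtain ⟨j, hj⟩ := Finset.nonempty_iff_ne_empty.mpr hd
    refine ⟨fun i => if i = j then α else false, ?_⟩
    simp only [shares, Finset.mem_filter, Finset.mem_univ, true_and]
    left
    cases α with
    | false => simp [xorOver]
    | true =>
      have h : ((Finset.univ.filter fun i => d i = true).filter fun x => x = j) = {j} := by
        rw [Finset.filter_eq', if_pos hj]
      simp [xorOver, h]

/-- Adversaries `(A₁, A₂, A₃)` in the game for the protocol; the second message is `(y, b)`. -/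
abbrev BlindAdversary (F : Family) (s : ℕ) : Type :=
  Adversary₃ (Challenge (F.n s)) (Fin (F.lK s)) (Fin (F.lY s) ⊕ Fin (F.lX s))
    (Fin (F.n s) × Fin 4)

open Classical in
/-- The probability that an adversary, controlling the server and the applicants in `M`, wins the
indistinguishability game for the protocol. -/
noncomputable def winIndBlindCanSup (F : Family) (PartInfo : F.PartInfoAlg) (s : ℕ)
    (A : BlindAdversary F s) : ℝ :=
  ∑ o : Challenge (F.n s) → Bool,
    if Differs o then 0 else
    if NoHonestSupported o then 0 else
    expect (PMF.uniformOfFintype Bool) fun c =>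
    expect (F.Gen s (support o c)) fun kt =>
    ∑ yb : Fin (F.lY s) ⊕ Fin (F.lX s) → Bool,
    expect (PartInfo s (kt.2, fun i => yb (.inl i))) fun v =>
    expect (phaseDist F s kt.1 (fun i => yb (.inl i)) (fun i => yb (.inr i)) v) fun α =>
    expect (PMF.uniformOfFinset (shares (support o c) α) (shares_nonempty _ _)) fun r =>
      weight (A.A₃.run (A.A₂.run (A.A₁.run A.advice noMsg o) kt.1 yb)
        (canMsg (corrupted o) r v) fun _ => c)

end BlindGHZ

/-!
The statement follows from indistinguishability with partial knowledge alone, by a non-uniform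
reduction.

*The shares carry no information.* Let `(M, d⁽⁰⁾, d⁽¹⁾)` be a first message with which the
adversary does not lose at once. For each `c`, either nobody is supported or some honest applicant
is. In the second case, flipping the share of that applicant exchanges the shares of `α` with those
of `1 - α` and is not seen by the corrupted applicants. So the bits `α̂ᵢ`, `i ∈ M`, are uniform,
whatever `α` is (`expect_shares_canMsg`). They may thus be drawn before the game starts, and `α`,
the only quantity that depends on `b`, disappears from the game (`winIndBlindCanSup_eq`).

*Fixing the first message and the shares.* The winning probability is now an average over the first
message `o` and the bits `r` of the shares, weighted by the probability of `o`; the weights add up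
to one because circuits are unitary (`Stage.sum_trace_run`). Hence some pair `(o, r)` does at least
as well as the average. The adversary in the game `IND-PARTIAL` (`reduction`) takes `o`, `r` and the
internal state after `o` as its advice, sends `o` and then runs the second and the third stage of
the given adversary. It needs no gates of its own: its third stage finds the shares on qubits of the
internal state, and the qubits that would have been measured to give `b` are kept untouched until
the end, which gives the same output distribution as measuring and discarding them
(`kraus_recall_mul_keep`, `reduction_weight`). Its size exceeds that of the given adversary by at
most `4 n`.

The operators of the stages are handled through Kraus operators: a stage acts on its internal state
by `ρ ↦ K ρ Kᴴ` (`Stage.run_eq_kraus`), and a circuit run in the presence of spectator wires has the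
Kraus operators of the original one tensored with the identity (`Stage.kraus_extend`).
-/

namespace BlindGHZ

open scoped Matrix ComplexOrder

/-! ### Circuits: unitarity and renaming of wires -/

section Circuits

variable {W W' E : Type}

theorem Gate.conjTranspose_mul_mat [Fintype W] [DecidableEq W] (g : Gate W) :
    (g.mat)ᴴ * g.mat = 1 := by
  cases g with
  | had i =>
    ext x z
    rw [Matrix.mul_apply, ← (Equiv.funSplitAt i Bool).symm.sum_comp, Fintype.sum_prod_type]
    -- With the bit on wire `i` fixed to `b`, only the string that agrees with `x` off `i` contributes.
    have key : ∀ b : Bool, ∑ r : {j // j ≠ i} → Bool,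
        (Gate.had i).matᴴ x ((Equiv.funSplitAt i Bool).symm (b, r)) *
          (Gate.had i).mat ((Equiv.funSplitAt i Bool).symm (b, r)) z =
        if ∀ j, j ≠ i → x j = z j then
          (if (b && x i) = true then -1 else 1) * (if (b && z i) = true then -1 else 1) / 2
        else 0 := by
      intro b
      let term : ({j // j ≠ i} → Bool) → ℂ := fun r =>
        (Gate.had i).matᴴ x ((Equiv.funSplitAt i Bool).symm (b, r)) *
          (Gate.had i).mat ((Equiv.funSplitAt i Bool).symm (b, r)) z
      have single : ∑ r, term r = term fun j => x j := Fintype.sum_eq_single _ ?_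
      refine single.trans ?_
      · simp only [term, Gate.mat, Matrix.conjTranspose_apply, Matrix.of_apply]
        have h1 : ∀ j, j ≠ i → (Equiv.funSplitAt i Bool).symm (b, fun j => x j) j = x j := by
          intro j hj; simp [hj]
        have h2 : (Equiv.funSplitAt i Bool).symm (b, fun j => x j) i = b := by simp
        have h3 : (∀ j, j ≠ i → (Equiv.funSplitAt i Bool).symm (b, fun j => x j) j = z j) ↔
            ∀ j, j ≠ i → x j = z j :=
          forall₂_congr fun j hj => by rw [h1 j hj]
        rw [if_pos h1, if_congr h3 rfl rfl, h2]
        have hs : (Real.sqrt 2 : ℂ) * (Real.sqrt 2 : ℂ) = 2 := by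
          rw [← Complex.ofReal_mul, Real.mul_self_sqrt (by norm_num)]; norm_num
        have hd : ∀ c d : ℂ, star c = c →
            star (c / (Real.sqrt 2 : ℂ)) * (d / (Real.sqrt 2 : ℂ)) = c * d / 2 := by
          intro c d hc
          rw [star_div₀, hc, Complex.star_def, Complex.conj_ofReal, div_mul_div_comm, hs]
        split_ifs <;> first | exact hd _ _ (by simp) | simp
      · intro r hr
        simp only [term, Gate.mat, Matrix.conjTranspose_apply, Matrix.of_apply]
        rw [if_neg, star_zero, zero_mul]
        intro h
        apply hr
        funext j
        have := h j j.2
        simpa [j.2] using this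
    rw [Fintype.sum_bool, key, key, Matrix.one_apply]
    by_cases h : ∀ j, j ≠ i → x j = z j
    · rw [if_pos h, if_pos h]
      by_cases hi : x i = z i
      · have hxz : x = z := by
          funext j
          by_cases hj : j = i
          · rw [hj, hi]
          · exact h j hj
        subst hxz
        cases x i <;> norm_num
      · have hxz : x ≠ z := fun hxz => hi (congrFun hxz i)
        rw [if_neg hxz]
        cases hx : x i <;> cases hz : z i
        · exact absurd (hx.trans hz.symm) hi
        · norm_num
        · norm_num
        · exact absurd (hx.trans hz.symm) hi
    · rw [if_neg h, if_neg h, if_neg (fun hxz => h fun j _ => by rw [hxz]), add_zero]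
  | phase i =>
    rw [Gate.mat, Matrix.diagonal_conjTranspose, Matrix.diagonal_mul_diagonal,
      ← Matrix.diagonal_one]
    congr 1
    funext x
    by_cases hx : x i = true
    · simp only [Pi.star_apply, hx, if_true]
      rw [Complex.star_def, ← Complex.exp_conj, ← Complex.exp_add, map_div₀,
        map_mul, Complex.conj_I, Complex.conj_ofReal, map_ofNat, neg_mul, neg_div, neg_add_cancel,
        Complex.exp_zero]
    · simp [hx]
  | cnot i j hij =>
    have inv : ∀ y : W → Bool, Function.update (Function.update y j (xor (y j) (y i))) j
        (xor (Function.update y j (xor (y j) (y i)) j)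
          (Function.update y j (xor (y j) (y i)) i)) = y := by
      intro y
      funext a
      by_cases ha : a = j
      · subst ha; simp [hij]
      · simp [ha]
    ext x z
    rw [Matrix.mul_apply, Finset.sum_eq_single (Function.update z j (xor (z j) (z i)))]
    · simp only [Gate.mat, Matrix.conjTranspose_apply, Matrix.of_apply, if_true, mul_one,
        Matrix.one_apply]
      by_cases hxz : x = z
      · simp [hxz]
      · rw [if_neg hxz, if_neg, star_zero]
        intro h
        apply hxz
        rw [← inv x, ← h, inv z]
    · intro y _ hy
      simp [Gate.mat, hy]
    · simp

theorem Circuit.mat_append_singleton [Fintype W] [DecidableEq W] (C : Circuit W)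
    (g : Gate W) :
    Circuit.mat (C ++ [g]) = g.mat * Circuit.mat C := by
  simp [Circuit.mat]

theorem Circuit.conjTranspose_mul_mat [Fintype W] [DecidableEq W] (C : Circuit W) :
    (C.mat)ᴴ * C.mat = 1 := by
  induction C using List.reverseRecOn with
  | nil => simp [Circuit.mat]
  | append_singleton C g ih =>
    rw [Circuit.mat_append_singleton, Matrix.conjTranspose_mul, Matrix.mul_assoc,
      ← Matrix.mul_assoc _ g.mat, g.conjTranspose_mul_mat, Matrix.one_mul, ih]

/-- Renaming of the wires of a gate. -/
def Gate.map (f : W ↪ W') : Gate W → Gate W'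
  | .had i => .had (f i)
  | .phase i => .phase (f i)
  | .cnot i j hij => .cnot (f i) (f j) (f.injective.ne hij)

/-- Assignments of bits to the wires `W'`, split along a partition of `W'` into `W` and `E`. -/
def splitWires (σ : W ⊕ E ≃ W') : (W' → Bool) ≃ (W → Bool) × (E → Bool) :=
  (Equiv.arrowCongr σ.symm (Equiv.refl Bool)).trans (Equiv.sumArrowEquivProdArrow W E Bool)

theorem splitWires_apply (σ : W ⊕ E ≃ W') (x : W' → Bool) :
    splitWires σ x = (fun i => x (σ (.inl i)), fun e => x (σ (.inr e))) := rfl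

/-- The operator that acts as `M` on the wires `W` and as the identity on the wires `E`. -/
noncomputable def spectate [Fintype E] (σ : W ⊕ E ≃ W')
    (M : Matrix (W → Bool) (W → Bool) ℂ) :
    Matrix (W' → Bool) (W' → Bool) ℂ :=
  (Matrix.kronecker M (1 : Matrix (E → Bool) (E → Bool) ℂ)).submatrix
    (splitWires σ) (splitWires σ)

theorem spectate_apply [Fintype E] (σ : W ⊕ E ≃ W') (M : Matrix (W → Bool) (W → Bool) ℂ)
    (x y : W' → Bool) :
    spectate σ M x y =
      if (fun e => x (σ (.inr e))) = (fun e => y (σ (.inr e))) then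
        M (fun i => x (σ (.inl i))) (fun i => y (σ (.inl i))) else 0 := by
  simp [spectate, splitWires_apply, Matrix.one_apply]

theorem spectate_mul [Fintype W] [DecidableEq W] [Fintype W'] [DecidableEq W'] [Fintype E]
    [DecidableEq E] (σ : W ⊕ E ≃ W')
    (M N : Matrix (W → Bool) (W → Bool) ℂ) :
    spectate σ (M * N) = spectate σ M * spectate σ N := by
  simp only [spectate]
  rw [Matrix.submatrix_mul_equiv]
  congr 1
  have := Matrix.mul_kronecker_mul M N (1 : Matrix (E → Bool) (E → Bool) ℂ)
    (1 : Matrix (E → Bool) (E → Bool) ℂ)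
  rw [Matrix.one_mul] at this
  exact this

theorem spectate_one [Fintype W] [Fintype W'] [Fintype E] (σ : W ⊕ E ≃ W') :
    spectate σ (1 : Matrix (W → Bool) (W → Bool) ℂ) = 1 := by
  have h : Matrix.kronecker (1 : Matrix (W → Bool) (W → Bool) ℂ)
      (1 : Matrix (E → Bool) (E → Bool) ℂ) = 1 := Matrix.one_kronecker_one
  rw [spectate, h, Matrix.submatrix_one_equiv]

/-- The embedding of the wires `W` into the wires `W'`. -/
def wireEmb (σ : W ⊕ E ≃ W') : W ↪ W' :=
  Function.Embedding.inl.trans σ.toEmbedding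

theorem Gate.mat_map [Fintype W] [DecidableEq W] [Fintype W'] [DecidableEq W'] [Fintype E]
    [DecidableEq E] (σ : W ⊕ E ≃ W') (g : Gate W) :
    (g.map (wireEmb σ)).mat = spectate σ g.mat := by
  have split : ∀ {P : W' → Prop}, (∀ w, P w) ↔ (∀ i, P (σ (.inl i))) ∧ ∀ e, P (σ (.inr e)) := by
    intro P
    rw [← σ.forall_congr_right, Sum.forall]
  ext x y
  rw [spectate_apply]
  cases g with
  | had i =>
    simp only [Gate.map, Gate.mat, Matrix.of_apply, wireEmb, Function.Embedding.trans_apply,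
      Function.Embedding.inl_apply, Equiv.coe_toEmbedding]
    rw [← ite_and]
    refine if_congr ?_ rfl rfl
    rw [split, funext_iff, and_comm]
    simp
  | phase i =>
    simp only [Gate.map, Gate.mat, Matrix.diagonal_apply, wireEmb, Function.Embedding.trans_apply,
      Function.Embedding.inl_apply, Equiv.coe_toEmbedding]
    rw [← ite_and]
    refine if_congr ?_ rfl rfl
    rw [funext_iff, split, funext_iff, funext_iff, and_comm]
  | cnot i j hij =>
    simp only [Gate.map, Gate.mat, Matrix.of_apply, wireEmb, Function.Embedding.trans_apply,
      Function.Embedding.inl_apply, Equiv.coe_toEmbedding]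
    rw [← ite_and]
    refine if_congr ?_ rfl rfl
    rw [funext_iff, split, funext_iff, funext_iff, and_comm]
    simp [Function.update_apply]

theorem Circuit.mat_map [Fintype W] [DecidableEq W] [Fintype W'] [DecidableEq W'] [Fintype E]
    [DecidableEq E] (σ : W ⊕ E ≃ W') (C : Circuit W) :
    Circuit.mat (C.map (Gate.map (wireEmb σ))) = spectate σ C.mat := by
  induction C using List.reverseRecOn with
  | nil => simp [Circuit.mat, spectate_one]
  | append_singleton C g ih =>
    rw [List.map_append, List.map_singleton, Circuit.mat_append_singleton, ih, Gate.mat_map,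
      Circuit.mat_append_singleton, spectate_mul]

end Circuits

/-! ### Kraus operators of a stage -/

section Stages

variable {q q' : ℕ} {I O : Type}

/-- The Kraus operator by which a stage with incoming message `m` acts on its internal state when
the outgoing message is measured to be `o`. -/
noncomputable def Stage.kraus [Fintype I] [DecidableEq I] (S : Stage q I O q')
    (m : I → Bool) (o : O → Bool) :
    Matrix (Bits q') (Bits q) ℂ :=
  S.circ.mat.submatrix (fun z w => Sum.elim o z (S.out w))
    (fun a => Sum.elim a (Sum.elim m fun _ => false))

/-- The message and the fresh qubits are adjoined to the internal state by an isometry, which maps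
a basis vector `a` to the basis vector `(a, m, 0)`. -/
theorem Stage.init_eq [Fintype I] (S : Stage q I O q') (ρ : Op q) (m : I → Bool) :
    S.init ρ m =
      (1 : Matrix (Fin q ⊕ I ⊕ Fin S.anc → Bool) (Fin q ⊕ I ⊕ Fin S.anc → Bool) ℂ).submatrix id
        (fun a : Bits q => Sum.elim a (Sum.elim m fun _ => false)) * ρ *
      ((1 : Matrix (Fin q ⊕ I ⊕ Fin S.anc → Bool) (Fin q ⊕ I ⊕ Fin S.anc → Bool) ℂ).submatrix id
        (fun a : Bits q => Sum.elim a (Sum.elim m fun _ => false)))ᴴ := by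
  have hx : ∀ (x : Fin q ⊕ I ⊕ Fin S.anc → Bool) (a : Bits q),
      x = Sum.elim a (Sum.elim m fun _ => false) ↔
        ((∀ i, x (.inr (.inl i)) = m i) ∧ ∀ i, x (.inr (.inr i)) = false) ∧
          a = fun j => x (.inl j) := by
    intro x a
    simp only [funext_iff, Sum.forall, Sum.elim_inl, Sum.elim_inr]
    constructor
    · rintro ⟨h1, h2, h3⟩
      exact ⟨⟨h2, h3⟩, fun i => (h1 i).symm⟩
    · rintro ⟨⟨h2, h3⟩, h1⟩
      exact ⟨fun i => (h1 i).symm, h2, h3⟩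
  ext x y
  simp only [Stage.init, Matrix.of_apply, Matrix.mul_apply, Matrix.conjTranspose_apply,
    Matrix.submatrix_apply, id, Matrix.one_apply, hx, ite_and, apply_ite star, star_one, star_zero]
  by_cases h1 : ∀ i, x (.inr (.inl i)) = m i <;> by_cases h2 : ∀ i, y (.inr (.inl i)) = m i <;>
    by_cases h3 : ∀ i, x (.inr (.inr i)) = false <;>
    by_cases h4 : ∀ i, y (.inr (.inr i)) = false <;>
    simp only [h1, h2, h3, h4, implies_true, if_true, if_false, zero_mul, mul_zero,
      Finset.sum_const_zero, ite_mul, mul_ite, one_mul, mul_one, Finset.sum_ite_eq',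
      Finset.mem_univ]

theorem Stage.run_eq_kraus [Fintype I] [DecidableEq I] (S : Stage q I O q')
    (ρ : Op q) (m : I → Bool) (o : O → Bool) :
    S.run ρ m o = S.kraus m o * ρ * (S.kraus m o)ᴴ := by
  rw [Stage.run, S.init_eq]
  simp only [← Matrix.mul_assoc]
  rw [Matrix.mul_assoc _ _ (S.circ.mat)ᴴ, ← Matrix.conjTranspose_mul]
  have h : S.circ.mat * (1 : Matrix (Fin q ⊕ I ⊕ Fin S.anc → Bool)
      (Fin q ⊕ I ⊕ Fin S.anc → Bool) ℂ).submatrix id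
        (fun a : Bits q => Sum.elim a (Sum.elim m fun _ => false)) =
      S.circ.mat.submatrix id (fun a : Bits q => Sum.elim a (Sum.elim m fun _ => false)) := by
    ext x a
    simp [Matrix.mul_apply, Matrix.one_apply]
  rw [h]
  rfl

theorem Stage.run_posSemidef [Fintype I] [DecidableEq I] (S : Stage q I O q')
    {ρ : Op q} (hρ : ρ.PosSemidef)
    (m : I → Bool) (o : O → Bool) : (S.run ρ m o).PosSemidef := by
  rw [S.run_eq_kraus]
  exact hρ.mul_mul_conjTranspose_same _

/-- The probabilities of the outgoing messages add up to one. -/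
theorem Stage.sum_trace_run [Fintype I] [DecidableEq I] [Fintype O] [DecidableEq O]
    (S : Stage q I O q') (ρ : Op q) (m : I → Bool) :
    ∑ o : O → Bool, (S.run ρ m o).trace = ρ.trace := by
  -- Summing over all outcomes gives the trace of the state before the measurement.
  have h : ∑ o : O → Bool, (S.run ρ m o).trace =
      (S.circ.mat * S.init ρ m * (S.circ.mat)ᴴ).trace := by
    rw [Matrix.trace, ← (splitWires S.out.symm).symm.sum_comp, Fintype.sum_prod_type]
    refine Finset.sum_congr rfl fun o _ => Finset.sum_congr rfl fun z _ => ?_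
    have hz : (splitWires S.out.symm).symm (o, z) = fun w => Sum.elim o z (S.out w) := by
      rw [Equiv.symm_apply_eq, splitWires_apply]
      simp
    rw [hz]
    rfl
  rw [h, Matrix.trace_mul_comm, ← Matrix.mul_assoc, S.circ.conjTranspose_mul_mat, Matrix.one_mul,
    S.init_eq, Matrix.trace_mul_comm, ← Matrix.mul_assoc]
  have h1 : ((1 : Matrix (Fin q ⊕ I ⊕ Fin S.anc → Bool)
      (Fin q ⊕ I ⊕ Fin S.anc → Bool) ℂ).submatrix id
        (fun a : Bits q => Sum.elim a (Sum.elim m fun _ => false)))ᴴ *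
      (1 : Matrix (Fin q ⊕ I ⊕ Fin S.anc → Bool)
      (Fin q ⊕ I ⊕ Fin S.anc → Bool) ℂ).submatrix id
        (fun a : Bits q => Sum.elim a (Sum.elim m fun _ => false)) = 1 := by
    ext a b
    simp only [Matrix.mul_apply, Matrix.conjTranspose_apply, Matrix.submatrix_apply, id,
      Matrix.one_apply, mul_ite, mul_one, mul_zero, Finset.sum_ite_eq', Finset.mem_univ, if_true]
    have : (Sum.elim b (Sum.elim m fun _ => false) : Fin q ⊕ I ⊕ Fin S.anc → Bool) =
        Sum.elim a (Sum.elim m fun _ => false) ↔ a = b := by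
      constructor
      · intro h
        funext j
        exact (congrFun h (.inl j)).symm
      · rintro rfl
        rfl
    simp [this, apply_ite star]
  rw [h1, Matrix.one_mul]

section Extend

variable {r r' : ℕ} {J P E : Type}

/-- The wires of an extended stage are those of the stage together with the spectators. -/
def Stage.extendWires (S : Stage q I O q') (ein : (Fin q ⊕ I) ⊕ E ≃ Fin r ⊕ J) :
    (Fin q ⊕ I ⊕ Fin S.anc) ⊕ E ≃ Fin r ⊕ J ⊕ Fin S.anc :=
  ((Equiv.sumAssoc (Fin q) I (Fin S.anc)).symm.sumCongr (Equiv.refl E)).trans <|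
  (Equiv.sumAssoc (Fin q ⊕ I) (Fin S.anc) E).trans <|
  ((Equiv.refl _).sumCongr (Equiv.sumComm (Fin S.anc) E)).trans <|
  (Equiv.sumAssoc (Fin q ⊕ I) E (Fin S.anc)).symm.trans <|
  (ein.sumCongr (Equiv.refl _)).trans <|
  Equiv.sumAssoc (Fin r) J (Fin S.anc)

/-- The stage that applies the circuit of `S` in the presence of the spectator wires `E`. Its
initial wires, internal and message together, are those of `S` and the spectators, and so are its
final wires; which of them are internal and which carry messages may differ from `S`. -/
def Stage.extend (S : Stage q I O q') (ein : (Fin q ⊕ I) ⊕ E ≃ Fin r ⊕ J)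
    (eout : O ⊕ (Fin q' ⊕ E) ≃ P ⊕ Fin r') : Stage r J P r' where
  anc := S.anc
  circ := S.circ.map (Gate.map (wireEmb (S.extendWires ein)))
  out := (S.extendWires ein).symm.trans <| (S.out.sumCongr (Equiv.refl E)).trans <|
    (Equiv.sumAssoc O (Fin q') E).trans eout

theorem Stage.size_extend (S : Stage q I O q') (ein : (Fin q ⊕ I) ⊕ E ≃ Fin r ⊕ J)
    (eout : O ⊕ (Fin q' ⊕ E) ≃ P ⊕ Fin r') : (S.extend ein eout).size = S.size := by
  simp [Stage.size, Stage.extend]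

theorem Stage.extend_out (S : Stage q I O q') (ein : (Fin q ⊕ I) ⊕ E ≃ Fin r ⊕ J)
    (eout : O ⊕ (Fin q' ⊕ E) ≃ P ⊕ Fin r') (u : (Fin q ⊕ I ⊕ Fin S.anc) ⊕ E) :
    (S.extend ein eout).out (S.extendWires ein u) =
      eout (Equiv.sumAssoc O (Fin q') E (S.out.sumCongr (Equiv.refl E) u)) :=
  congrArg (fun u => eout (Equiv.sumAssoc O (Fin q') E (S.out.sumCongr (Equiv.refl E) u)))
    ((S.extendWires ein).symm_apply_apply u)

theorem Stage.kraus_extend [Fintype I] [DecidableEq I] [Fintype J] [DecidableEq J] [Fintype E]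
    [DecidableEq E] (S : Stage q I O q') (ein : (Fin q ⊕ I) ⊕ E ≃ Fin r ⊕ J)
    (eout : O ⊕ (Fin q' ⊕ E) ≃ P ⊕ Fin r') (m : J → Bool) (p : P → Bool)
    (z : Bits r') (a : Bits r) :
    (S.extend ein eout).kraus m p z a =
      if (fun e => Sum.elim p z (eout (.inr (.inr e)))) =
          (fun e => Sum.elim a m (ein (.inr e))) then
        S.kraus (fun i => Sum.elim a m (ein (.inl (.inr i))))
          (fun i => Sum.elim p z (eout (.inl i)))
          (fun i => Sum.elim p z (eout (.inr (.inl i))))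
          (fun i => Sum.elim a m (ein (.inl (.inl i)))) else 0 := by
  have hin : ∀ u : (Fin q ⊕ I) ⊕ E,
      (Sum.elim a (Sum.elim m fun _ => false) : Fin r ⊕ J ⊕ Fin S.anc → Bool)
        (Equiv.sumAssoc (Fin r) J (Fin S.anc) (.inl (ein u))) = Sum.elim a m (ein u) := by
    intro u
    cases ein u <;> rfl
  have hmat : (S.extend ein eout).circ.mat = spectate (S.extendWires ein) S.circ.mat :=
    Circuit.mat_map _ _
  rw [Stage.kraus, Matrix.submatrix_apply, hmat]
  refine (spectate_apply _ _ _ _).trans ?_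
  refine if_congr ?_ ?_ rfl
  · refine Eq.congr ?_ ?_
    · funext e
      exact congrArg (Sum.elim p z) (S.extend_out ein eout (.inr e))
    · funext e
      exact hin (.inr e)
  · rw [Stage.kraus, Matrix.submatrix_apply]
    congr 1
    · funext w
      refine (congrArg (Sum.elim p z) (S.extend_out ein eout (.inl w))).trans ?_
      rw [Equiv.sumCongr_apply, Sum.map_inl]
      cases S.out w <;> rfl
    · funext w
      rcases w with w | w | w
      · exact hin (.inl (.inl w))
      · exact hin (.inl (.inr w))
      · rfl

end Extend

end Stages

/-! ### Expectations -/

section Expectations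

variable {α β : Type} [Fintype α] [Fintype β]

theorem sum_toReal_eq_one (μ : PMF α) : ∑ a, (μ a).toReal = 1 := by
  rw [← ENNReal.toReal_sum fun a _ => μ.apply_ne_top a, ← tsum_fintype (L := .unconditional _),
    μ.tsum_coe, ENNReal.toReal_one]

theorem expect_const (μ : PMF α) (x : ℝ) : expect μ (fun _ => x) = x := by
  rw [expect, ← Finset.sum_mul, sum_toReal_eq_one, one_mul]

theorem expect_le (μ : PMF α) {g : α → ℝ} {x : ℝ} (h : ∀ a, g a ≤ x) : expect μ g ≤ x := by
  rw [← expect_const μ x]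
  exact Finset.sum_le_sum fun a _ => mul_le_mul_of_nonneg_left (h a) ENNReal.toReal_nonneg

theorem expect_mul (μ : PMF α) (g : α → ℝ) (x : ℝ) :
    expect μ (fun a => g a * x) = expect μ g * x := by
  simp only [expect, Finset.sum_mul, mul_assoc]

theorem expect_sum (μ : PMF α) (g : α → β → ℝ) :
    expect μ (fun a => ∑ b, g a b) = ∑ b, expect μ fun a => g a b := by
  simp only [expect, Finset.mul_sum]
  exact Finset.sum_comm

theorem expect_comm (μ : PMF α) (ν : PMF β) (g : α → β → ℝ) :
    expect μ (fun a => expect ν (g a)) = expect ν fun b => expect μ fun a => g a b := by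
  simp only [expect, Finset.mul_sum]
  rw [Finset.sum_comm]
  exact Finset.sum_congr rfl fun _ _ => Finset.sum_congr rfl fun _ _ => by ring

theorem expect_uniformOfFinset [DecidableEq α] (S : Finset α) (hS : S.Nonempty) (g : α → ℝ) :
    expect (PMF.uniformOfFinset S hS) g = (∑ a ∈ S, g a) / S.card := by
  simp only [expect, PMF.uniformOfFinset_apply]
  rw [div_eq_inv_mul, Finset.mul_sum, ← Finset.sum_filter_add_sum_filter_not Finset.univ (· ∈ S)]
  rw [Finset.sum_eq_zero (s := Finset.univ.filter (· ∉ S))]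
  · rw [add_zero, Finset.filter_mem_eq_inter, Finset.univ_inter]
    exact Finset.sum_congr rfl fun a ha => by simp [ha]
  · intro a ha
    simp [(Finset.mem_filter.mp ha).2]

theorem expect_uniformOfFintype [DecidableEq α] [Nonempty α] (g : α → ℝ) :
    expect (PMF.uniformOfFintype α) g = (∑ a, g a) / Fintype.card α := by
  rw [PMF.uniformOfFintype, expect_uniformOfFinset, Finset.card_univ]

end Expectations

/-! ### Shares seen by the corrupted applicants -/

section Shares

variable {n : ℕ}

/-- Flipping one bit. -/
def flipBit (j : Fin n) (r : Bits n) : Bits n := Function.update r j (!r j)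

theorem flipBit_flipBit (j : Fin n) (r : Bits n) : flipBit j (flipBit j r) = r := by
  simp [flipBit]

theorem xorOver_flipBit {S : Finset (Fin n)} {j : Fin n} (hj : j ∈ S) (r : Bits n) :
    xorOver S (flipBit j r) = !xorOver S r := by
  have key : ∀ r : Bits n, xorOver S r =
      xor (r j) (decide (Odd ((S.erase j).filter fun i => r i = true).card)) := by
    intro r
    rw [xorOver, ← Finset.insert_erase hj, Finset.filter_insert, Finset.erase_insert (by simp)]
    cases r j with
    | false => simp
    | true =>
      rw [if_pos rfl, Finset.card_insert_of_notMem (by simp), Bool.true_xor,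
        ← decide_not]
      exact decide_eq_decide.mpr Nat.odd_add_one
  have h : ((S.erase j).filter fun i => flipBit j r i = true) =
      (S.erase j).filter fun i => r i = true :=
    Finset.filter_congr fun i hi => by
      rw [flipBit, Function.update_of_ne (Finset.ne_of_mem_erase hi)]
  rw [key, key r, h, flipBit, Function.update_self, Bool.not_xor]

theorem flipBit_mem_shares {d : Bits n} {α : Bool} {j : Fin n} (hj : d j = true) (r : Bits n) :
    flipBit j r ∈ shares d α ↔ r ∉ shares d α := by
  have hmem : j ∈ Finset.univ.filter fun i => d i = true := by simp [hj]
  have hne : (Finset.univ.filter fun i => d i = true) ≠ ∅ := Finset.ne_empty_of_mem hmem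
  simp only [shares, Finset.mem_filter, Finset.mem_univ, true_and, hne, or_false,
    xorOver_flipBit hmem]
  cases xorOver (Finset.univ.filter fun i => d i = true) r <;> cases α <;> simp

/-- A quantity that ignores the share of some supported applicant has the same average over the
shares of `α` as over all strings: flipping this share exchanges the shares of `α` with the other
strings. -/
theorem sum_shares {d : Bits n} {α : Bool} {j : Fin n} (hj : d j = true) {g : Bits n → ℝ}
    (hg : ∀ r, g (flipBit j r) = g r) : ∑ r, g r = 2 * ∑ r ∈ shares d α, g r := by
  have h : ∑ r ∈ Finset.univ.filter (· ∉ shares d α), g r = ∑ r ∈ shares d α, g r := by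
    refine Finset.sum_nbij' (flipBit j) (flipBit j) ?_ ?_ ?_ ?_ ?_
    · intro r hr
      exact (flipBit_mem_shares hj r).mpr (Finset.mem_filter.mp hr).2
    · intro r hr
      rw [Finset.mem_filter, flipBit_mem_shares hj, not_not]
      exact ⟨Finset.mem_univ _, hr⟩
    · intro r _
      exact flipBit_flipBit j r
    · intro r _
      exact flipBit_flipBit j r
    · intro r _
      exact (hg r).symm
  rw [← Finset.sum_filter_add_sum_filter_not Finset.univ (· ∈ shares d α), h,
    Finset.filter_mem_eq_inter, Finset.univ_inter, two_mul]

theorem expect_shares {d : Bits n} {α : Bool} {g : Bits n → ℝ}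
    (h : (∀ i, d i = false) ∨ ∃ j, d j = true ∧ ∀ r, g (flipBit j r) = g r) :
    expect (PMF.uniformOfFinset (shares d α) (shares_nonempty d α)) g =
      expect (PMF.uniformOfFintype (Bits n)) g := by
  rw [expect_uniformOfFinset, expect_uniformOfFintype]
  rcases h with h | ⟨j, hj, hg⟩
  · have : shares d α = Finset.univ := by simp [shares, h]
    rw [this, Finset.card_univ]
  · have hcard : (Fintype.card (Bits n) : ℝ) = 2 * (shares d α).card := by
      have := sum_shares (α := α) hj (g := fun _ => 1) fun _ => rfl
      simpa using this
    rw [sum_shares (α := α) hj hg, hcard, mul_div_mul_left _ _ two_ne_zero]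

theorem canMsg_flipBit {M : Finset (Fin n)} {j : Fin n} (hj : j ∉ M) (r : Bits n)
    (v : Fin n → Info) : canMsg M (flipBit j r) v = canMsg M r v := by
  funext w
  by_cases hw : w.1 ∈ M
  · have : flipBit j r w.1 = r w.1 := by
      rw [flipBit, Function.update_of_ne]
      rintro rfl
      exact hj hw
    simp only [canMsg, this]
  · simp [canMsg, hw]

/-- Under the conditions of the game, the shares of the corrupted applicants are uniform whatever
the phase is: either nobody is supported, or some honest applicant is. -/
theorem expect_shares_canMsg {o : Challenge n → Bool} (hd : ¬ Differs o)
    (hs : ¬ NoHonestSupported o) (c α : Bool) (v : Fin n → Info)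
    (g : (Fin n × Fin 4 → Bool) → ℝ) :
    expect (PMF.uniformOfFinset (shares (support o c) α) (shares_nonempty _ _))
        (fun r => g (canMsg (corrupted o) r v)) =
      expect (PMF.uniformOfFintype (Bits n)) fun r => g (canMsg (corrupted o) r v) := by
  apply expect_shares
  by_cases h0 : ∀ i, support o c i = false
  · exact Or.inl h0
  · right
    suffices h : ∃ j, j ∉ corrupted o ∧ support o c j = true by
      obtain ⟨j, hj, hjs⟩ := h
      exact ⟨j, hjs, fun r => by rw [canMsg_flipBit hj]⟩
    by_contra! hall
    simp only [Bool.not_eq_true] at hall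
    push Not at h0
    obtain ⟨i, hi⟩ := h0
    rw [ne_eq, Bool.not_eq_false] at hi
    have hiM : i ∈ corrupted o := by
      by_contra hiM
      rw [hall i hiM] at hi
      exact Bool.false_ne_true hi
    have heq : support o false i = support o true i := by
      by_contra hne
      exact hd ⟨i, hiM, hne⟩
    refine hs ⟨⟨i, hiM, ?_⟩, ?_⟩
    · cases c
      · exact hi
      · rw [heq, hi]
    · cases c
      · exact Or.inl hall
      · exact Or.inr hall

end Shares

/-! ### Simulation of the stages in the game for partial information -/

section Simulation

variable {q q' n l : ℕ} {I O : Type}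

/-- The stage that runs no gates and measures some of its qubits. -/
def Stage.emit (e : Fin q ≃ O ⊕ Fin q') : Stage q Empty O q' where
  anc := 0
  circ := []
  out := (Equiv.sumEmpty (Fin q) (Empty ⊕ Fin 0)).trans e

theorem Stage.kraus_emit (e : Fin q ≃ O ⊕ Fin q') (m : Empty → Bool) (o : O → Bool) (z : Bits q')
    (a : Bits q) :
    (Stage.emit e).kraus m o z a = if a = fun j => Sum.elim o z (e j) then 1 else 0 := by
  rw [Stage.kraus, Matrix.submatrix_apply]
  have hmat : (Stage.emit e).circ.mat = 1 := rfl
  rw [hmat, Matrix.one_apply]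
  refine if_congr ?_ rfl rfl
  constructor
  · intro h
    funext j
    exact (congrFun h (.inl j)).symm
  · rintro rfl
    funext w
    rcases w with w | w | w
    · rfl
    · exact w.elim
    · exact w.elim0

/-- The initial wires of a stage that, compared to `S`, keeps `n` further qubits. -/
def keepIn (q n : ℕ) (I : Type) : (Fin q ⊕ I) ⊕ Fin n ≃ Fin (q + n) ⊕ I :=
  (Equiv.sumAssoc (Fin q) I (Fin n)).trans <|
  ((Equiv.refl _).sumCongr (Equiv.sumComm I (Fin n))).trans <|
  (Equiv.sumAssoc (Fin q) (Fin n) I).symm.trans <|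
  finSumFinEquiv.sumCongr (Equiv.refl I)

/-- The final wires of a stage that keeps, besides `n` further qubits, a part of the message. -/
def keepOut (q' n l : ℕ) (O : Type) :
    (O ⊕ Fin l) ⊕ (Fin q' ⊕ Fin n) ≃ O ⊕ Fin (l + (q' + n)) :=
  (Equiv.sumAssoc O (Fin l) (Fin q' ⊕ Fin n)).trans <|
  (Equiv.refl O).sumCongr <|
  ((Equiv.refl (Fin l)).sumCongr finSumFinEquiv).trans finSumFinEquiv

/-- The stage that behaves like `S`, but keeps the qubits on the wires `Fin l` instead of measuring
and sending them; `n` further qubits are passed on. -/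
def Stage.keep (S : Stage q I (O ⊕ Fin l) q') (n : ℕ) : Stage (q + n) I O (l + (q' + n)) :=
  S.extend (keepIn q n I) (keepOut q' n l O)

theorem Stage.kraus_keep [Fintype I] [DecidableEq I] (S : Stage q I (O ⊕ Fin l) q')
    (m : I → Bool) (y : O → Bool) (b : Bits l) (z : Bits q') (r' : Bits n) (a : Bits q)
    (r : Bits n) :
    (S.keep n).kraus m y (Fin.append b (Fin.append z r')) (Fin.append a r) =
      if r' = r then S.kraus m (Sum.elim y b) z a else 0 := by
  rw [Stage.keep, Stage.kraus_extend]
  refine if_congr (Eq.congr ?_ ?_) ?_ rfl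
  · funext e
    exact (Fin.append_right b _ (Fin.natAdd q' e)).trans (Fin.append_right z r' e)
  · funext e
    exact Fin.append_right a r e
  · congr 1
    · funext u
      rcases u with u | u
      · rfl
      · exact Fin.append_left b _ u
    · funext u
      exact (Fin.append_right b _ (Fin.castAdd n u)).trans (Fin.append_left z r' u)
    · funext u
      exact Fin.append_left a r u

/-- The four wires of every applicant: the last one, and the first three. -/
def splitLast (n : ℕ) : Fin n × Fin 4 ≃ Fin n ⊕ Fin n × Fin 3 where
  toFun p := Fin.lastCases (Sum.inl p.1) (fun j => Sum.inr (p.1, j)) p.2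
  invFun := Sum.elim (fun i => (i, Fin.last 3)) fun p => (p.1, p.2.castSucc)
  left_inv := by
    rintro ⟨i, j⟩
    refine Fin.lastCases ?_ (fun j => ?_) j
    · simp only [Fin.lastCases_last, Sum.elim_inl]
    · simp only [Fin.lastCases_castSucc, Sum.elim_inr]
  right_inv := by
    rintro (i | ⟨i, j⟩)
    · simp only [Sum.elim_inl, Fin.lastCases_last]
    · simp only [Sum.elim_inr, Fin.lastCases_castSucc]

/-- The initial wires of a stage that finds the last of the four wires of every applicant in its
internal state, together with `l` further qubits. -/
def recallIn (q n l : ℕ) :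
    (Fin q ⊕ Fin n × Fin 4) ⊕ Fin l ≃ Fin (l + (q + n)) ⊕ Fin n × Fin 3 :=
  (((Equiv.refl (Fin q)).sumCongr (splitLast n)).sumCongr (Equiv.refl (Fin l))).trans <|
  ((Equiv.sumAssoc (Fin q) (Fin n) (Fin n × Fin 3)).symm.sumCongr (Equiv.refl (Fin l))).trans <|
  (Equiv.sumComm _ (Fin l)).trans <|
  (Equiv.sumAssoc (Fin l) (Fin q ⊕ Fin n) (Fin n × Fin 3)).symm.trans <|
  (((Equiv.refl (Fin l)).sumCongr finSumFinEquiv).trans finSumFinEquiv).sumCongr (Equiv.refl _)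

/-- The stage that behaves like `S`, but reads the last of the four wires of every applicant from
its internal state; `l` further qubits are left untouched. -/
def Stage.recall (S : Stage q (Fin n × Fin 4) O q') (l : ℕ) :
    Stage (l + (q + n)) (Fin n × Fin 3) O (q' + l) :=
  S.extend (recallIn q n l) ((Equiv.refl O).sumCongr finSumFinEquiv)

/-- The string `b` is unchanged, and `r` takes the place of the last wires of the message. -/
theorem Stage.kraus_recall (S : Stage q (Fin n × Fin 4) O q') (m : Fin n × Fin 3 → Bool)
    (o : O → Bool) (z : Bits q') (b' b : Bits l) (a : Bits q) (r : Bits n) :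
    (S.recall l).kraus m o (Fin.append z b') (Fin.append b (Fin.append a r)) =
      if b' = b then S.kraus (fun p => Sum.elim r m (splitLast n p)) o z a else 0 := by
  rw [Stage.recall, Stage.kraus_extend]
  refine if_congr (Eq.congr ?_ ?_) ?_ rfl
  · funext e
    exact Fin.append_right z b' e
  · funext e
    exact Fin.append_left b _ e
  · congr 1
    · funext p
      simp only [recallIn, Equiv.trans_apply, Equiv.sumCongr_apply, Sum.map_inl, Sum.map_inr]
      cases splitLast n p with
      | inl i => exact (Fin.append_right b _ (Fin.natAdd q i)).trans (Fin.append_right a r i)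
      | inr p => rfl
    · funext u
      exact Fin.append_left z b' u
    · funext u
      exact (Fin.append_right b _ (Fin.castAdd n u)).trans (Fin.append_left a r u)

theorem canMsg_eq_elim (M : Finset (Fin n)) (r : Bits n) (v : Fin n → Info) :
    (fun p => Sum.elim (fun i => decide (i ∈ M) && r i) (partialMsg M v) (splitLast n p)) =
      canMsg M r v := by
  funext ⟨i, j⟩
  refine Fin.lastCases ?_ (fun j => ?_) j
  · simp only [splitLast, Equiv.coe_fn_mk, Fin.lastCases_last, Sum.elim_inl, canMsg]
    rfl
  · simp only [splitLast, Equiv.coe_fn_mk, Fin.lastCases_castSucc, Sum.elim_inr, partialMsg, canMsg]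
    fin_cases j <;> rfl

/-- The isometry that maps the basis vector `a` to the basis vector `ι a`. -/
noncomputable def basisMap (ι : Bits q → Bits q') : Matrix (Bits q') (Bits q) ℂ :=
  (1 : Matrix (Bits q') (Bits q') ℂ).submatrix id ι

theorem mul_basisMap {R : Type} (ι : Bits q → Bits q') (M : Matrix R (Bits q') ℂ) (x : R)
    (a : Bits q) : (M * basisMap ι) x a = M x (ι a) := by
  simp [basisMap, Matrix.mul_apply, Matrix.one_apply]

theorem conjTranspose_basisMap_mul {ι : Bits q → Bits q'} (hι : Function.Injective ι) :
    (basisMap ι)ᴴ * basisMap ι = 1 := by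
  ext a b
  rw [mul_basisMap, Matrix.conjTranspose_apply, basisMap, Matrix.submatrix_apply, id,
    Matrix.one_apply, Matrix.one_apply, if_congr (hι.eq_iff.trans eq_comm) rfl rfl]
  split_ifs <;> simp

theorem sum_bits_append {m m' : ℕ} {R : Type} [AddCommMonoid R] (g : Bits (m + m') → R) :
    ∑ x, g x = ∑ a : Bits m, ∑ b : Bits m', g (Fin.append a b) := by
  rw [← (Fin.appendEquiv m m').sum_comp, Fintype.sum_prod_type]
  rfl

/-- A kept stage followed by a recalling stage, on an internal state that contains the bits `r`:
the wires `b` that have not been measured stay as they are, so that every value of `b` contributes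
one copy of the original two stages. -/
theorem kraus_recall_mul_keep [Fintype I] [DecidableEq I] {q'' : ℕ} {O' : Type}
    (S : Stage q I (O ⊕ Fin l) q') (S' : Stage q' (Fin n × Fin 4) O' q'') (k : I → Bool)
    (y : O → Bool) (m : Fin n × Fin 3 → Bool) (c : O' → Bool) (r : Bits n) (z : Bits q'')
    (b : Bits l) (a : Bits q) :
    ((S'.recall l).kraus m c * ((S.keep n).kraus k y * basisMap fun a : Bits q => Fin.append a r))
        (Fin.append z b) a =
      (S'.kraus (fun p => Sum.elim r m (splitLast n p)) c * S.kraus k (Sum.elim y b)) z a := by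
  rw [Matrix.mul_apply, sum_bits_append, Matrix.mul_apply]
  simp only [mul_basisMap]
  rw [Finset.sum_eq_single b]
  · rw [sum_bits_append]
    refine Finset.sum_congr rfl fun w _ => ?_
    rw [Finset.sum_eq_single r]
    · rw [Stage.kraus_recall, Stage.kraus_keep, if_pos rfl, if_pos rfl]
    · intro r' _ hr
      rw [Stage.kraus_keep, if_neg hr, mul_zero]
    · simp
  · intro b' _ hb
    rw [sum_bits_append]
    refine Finset.sum_eq_zero fun w _ => Finset.sum_eq_zero fun r' _ => ?_
    rw [Stage.kraus_recall, if_neg hb.symm, zero_mul]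
  · simp

end Simulation

/-! ### The reduction -/

section Reduction

variable {F : Family} {s : ℕ}

theorem trace_mul_conjTranspose_append {q m m' : ℕ} (G : Matrix (Bits (m + m')) (Bits q) ℂ)
    (H : Bits m' → Matrix (Bits m) (Bits q) ℂ) (h : ∀ z b a, G (Fin.append z b) a = H b z a)
    (σ : Op q) : (G * σ * Gᴴ).trace = ∑ b, (H b * σ * (H b)ᴴ).trace := by
  simp only [Matrix.trace, Matrix.diag_apply]
  rw [sum_bits_append, Finset.sum_comm]
  simp only [Matrix.mul_apply, Matrix.conjTranspose_apply, h]

/-- The wires of the advice of the reduction: those of the first message, of the internal state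
that follows it, and of the shares. -/
noncomputable def adviceWires (n q : ℕ) :
    Fin (Fintype.card (Challenge n ⊕ Fin (q + n))) ≃ Challenge n ⊕ Fin (q + n) :=
  (Fintype.equivFin _).symm

/-- The basis vectors of the advice of the reduction. -/
noncomputable def adviceBits {n q : ℕ} (o : Challenge n → Bool) (r : Bits n) (a : Bits q) :
    Bits (Fintype.card (Challenge n ⊕ Fin (q + n))) :=
  fun j => Sum.elim o (Fin.append a r) (adviceWires n q j)

theorem adviceBits_injective {n q : ℕ} (o : Challenge n → Bool) (r : Bits n) :
    Function.Injective (adviceBits (q := q) o r) := by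
  intro a a' h
  funext i
  have := congrFun h ((adviceWires n q).symm (.inr (Fin.castAdd n i)))
  simpa [adviceBits] using this

/-- The adversary in the game `IND-PARTIAL` built from an adversary `A` against the protocol. Its
advice contains a first message `o`, the internal state `σ` in which `A` continues, and the bits `r`
that are handed to the corrupted applicants as shares. It sends `o`, then runs the second and the
third stage of `A`, without measuring the string `b` that `A` would send along with `y`. -/
noncomputable def reduction (A : BlindAdversary F s) (σ : Op A.q₁) (hσ : σ.PosSemidef)
    (hσ' : σ.trace = 1) (o : Challenge (F.n s) → Bool) (r : Bits (F.n s)) :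
    PartialAdversary F s where
  q₀ := Fintype.card (Challenge (F.n s) ⊕ Fin (A.q₁ + F.n s))
  q₁ := A.q₁ + F.n s
  q₂ := F.lX s + (A.q₂ + F.n s)
  q₃ := A.q₃ + F.lX s
  advice := basisMap (adviceBits o r) * σ * (basisMap (adviceBits o r))ᴴ
  advice_pos := hσ.mul_mul_conjTranspose_same _
  advice_trace := by
    rw [Matrix.trace_mul_comm, ← Matrix.mul_assoc,
      conjTranspose_basisMap_mul (adviceBits_injective o r), Matrix.one_mul, hσ']
  A₁ := Stage.emit (adviceWires (F.n s) A.q₁)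
  A₂ := A.A₂.keep (F.n s)
  A₃ := A.A₃.recall (F.lX s)

theorem size_reduction_le (A : BlindAdversary F s) (σ : Op A.q₁) (hσ : σ.PosSemidef)
    (hσ' : σ.trace = 1) (o : Challenge (F.n s) → Bool) (r : Bits (F.n s)) :
    (reduction A σ hσ hσ' o r).size ≤ 4 * F.n s + A.size := by
  have h1 : A.q₁ ≤ A.q₀ + A.A₁.anc := by
    have := Fintype.card_congr A.A₁.out
    simp at this
    omega
  have h2 : (reduction A σ hσ hσ' o r).size =
      Fintype.card (Challenge (F.n s) ⊕ Fin (A.q₁ + F.n s)) + 0 + A.A₂.size + A.A₃.size := by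
    rw [← A.A₂.size_extend (keepIn A.q₁ (F.n s) (Fin (F.lK s)))
        (keepOut A.q₂ (F.n s) (F.lX s) (Fin (F.lY s))),
      ← A.A₃.size_extend (recallIn A.q₂ (F.n s) (F.lX s))
        ((Equiv.refl Unit).sumCongr finSumFinEquiv)]
    rfl
  rw [h2]
  simp only [Adversary₃.size, Stage.size]
  simp [Challenge]
  omega

theorem emit_kraus_mul_basisMap {n q : ℕ} (o o' : Challenge n → Bool) (r : Bits n) :
    (Stage.emit (adviceWires n q)).kraus noMsg o' * basisMap (adviceBits (q := q) o r) =
      if o' = o then basisMap fun a : Bits q => Fin.append a r else 0 := by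
  have heq : ∀ (z : Bits (q + n)) (a : Bits q),
      (adviceBits o r a = fun j => Sum.elim o' z (adviceWires n q j)) ↔
        o' = o ∧ z = Fin.append a r := by
    intro z a
    constructor
    · intro h
      have h' : ∀ u, Sum.elim o (Fin.append a r) u = Sum.elim o' z u := by
        intro u
        have := congrFun h ((adviceWires n q).symm u)
        simpa only [adviceBits, Equiv.apply_symm_apply] using this
      exact ⟨funext fun u => (h' (.inl u)).symm, funext fun u => (h' (.inr u)).symm⟩
    · rintro ⟨rfl, rfl⟩
      rfl
  ext z a
  rw [mul_basisMap, Stage.kraus_emit, if_congr (heq z a) rfl rfl, ite_and]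
  split_ifs with h1 h2 <;> simp_all [basisMap, Matrix.one_apply]

theorem reduction_weight (A : BlindAdversary F s) (σ : Op A.q₁) (hσ : σ.PosSemidef)
    (hσ' : σ.trace = 1) (o : Challenge (F.n s) → Bool) (r : Bits (F.n s))
    (o' : Challenge (F.n s) → Bool) (k : Bits (F.lK s)) (y : Bits (F.lY s))
    (m : Fin (F.n s) × Fin 3 → Bool) (c : Unit → Bool) :
    weight ((reduction A σ hσ hσ' o r).A₃.run ((reduction A σ hσ hσ' o r).A₂.run
        ((reduction A σ hσ hσ' o r).A₁.run (reduction A σ hσ hσ' o r).advice noMsg o') k y) m c) =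
      if o' = o then ∑ b : Bits (F.lX s), weight (A.A₃.run (A.A₂.run σ k (Sum.elim y b))
        (fun p => Sum.elim r m (splitLast (F.n s) p)) c) else 0 := by
  have hrun : ∀ {q q' q'' : ℕ} (K : Matrix (Bits q'') (Bits q') ℂ)
      (K' : Matrix (Bits q') (Bits q) ℂ)
      (ρ : Op q), K * (K' * ρ * K'ᴴ) * Kᴴ = (K * K') * ρ * (K * K')ᴴ := by
    intro q q' q'' K K' ρ
    rw [Matrix.conjTranspose_mul]
    simp only [Matrix.mul_assoc]
  simp only [reduction, Stage.run_eq_kraus, hrun]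
  rw [emit_kraus_mul_basisMap]
  split_ifs with h
  · rw [weight, trace_mul_conjTranspose_append _ _ fun z b a =>
      kraus_recall_mul_keep A.A₂ A.A₃ k y m c r z b a, Complex.re_sum]
    rfl
  · simp [weight]

end Reduction

/-! ### Comparison of the two games -/

section Games

variable {F : Family} {s : ℕ}

/-- The probability, for the first message `o`, that the second and the third stage of `A`, started
in the (possibly unnormalized) state `ρ`, guess `c` if the shares of the corrupted applicants are
taken from `r`. -/
noncomputable def guessProb (PartInfo : F.PartInfoAlg) (A : BlindAdversary F s)
    (o : Challenge (F.n s) → Bool) (ρ : Op A.q₁) (r : Bits (F.n s)) : ℝ :=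
  expect (PMF.uniformOfFintype Bool) fun c =>
  expect (F.Gen s (support o c)) fun kt =>
  ∑ yb : Fin (F.lY s) ⊕ Fin (F.lX s) → Bool,
  expect (PartInfo s (kt.2, fun i => yb (.inl i))) fun v =>
    weight (A.A₃.run (A.A₂.run ρ kt.1 yb) (canMsg (corrupted o) r v) fun _ => c)

theorem weight_smul {q : ℕ} (x : ℝ) (ρ : Op q) : weight ((x : ℂ) • ρ) = weight ρ * x := by
  rw [weight, Matrix.trace_smul, smul_eq_mul, Complex.re_ofReal_mul, mul_comm, weight]

theorem Stage.run_smul {q q' : ℕ} {I O : Type} [Fintype I] [DecidableEq I] (S : Stage q I O q')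
    (x : ℂ) (ρ : Op q) (m : I → Bool) (o : O → Bool) : S.run (x • ρ) m o = x • S.run ρ m o := by
  simp only [S.run_eq_kraus, Matrix.mul_smul, Matrix.smul_mul]

theorem guessProb_smul (PartInfo : F.PartInfoAlg) (A : BlindAdversary F s)
    (o : Challenge (F.n s) → Bool) (x : ℝ) (ρ : Op A.q₁) (r : Bits (F.n s)) :
    guessProb PartInfo A o ((x : ℂ) • ρ) r = guessProb PartInfo A o ρ r * x := by
  simp only [guessProb, Stage.run_smul, weight_smul, expect_mul, ← Finset.sum_mul]

/-- The reduction wins with the probability with which `A` guesses from the state in its advice. -/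
theorem winIndPartial_reduction (PartInfo : F.PartInfoAlg) (A : BlindAdversary F s)
    {σ : Op A.q₁} (hσ : σ.PosSemidef) (hσ' : σ.trace = 1) {o : Challenge (F.n s) → Bool}
    (ho : ¬ Differs o) (r : Bits (F.n s)) :
    winIndPartial F PartInfo s
        (reduction A σ hσ hσ' o fun i => decide (i ∈ corrupted o) && r i) =
      guessProb PartInfo A o σ r := by
  rw [winIndPartial, Finset.sum_eq_single o]
  · rw [if_neg ho, guessProb]
    congr 1
    funext c
    congr 1
    funext kt
    rw [← (Equiv.sumArrowEquivProdArrow _ _ Bool).symm.sum_comp, Fintype.sum_prod_type]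
    refine Finset.sum_congr rfl fun y _ => ?_
    simp only [reduction_weight, if_true, canMsg_eq_elim]
    rw [expect_sum]
    rfl
  · intro o' _ h
    simp only [reduction_weight, h, if_false, expect_const, Finset.sum_const_zero, ite_self]
  · simp

/-- In the game for the protocol, the shares of the corrupted applicants may be drawn uniformly and
before everything else. -/
theorem winIndBlindCanSup_eq (PartInfo : F.PartInfoAlg) (A : BlindAdversary F s) :
    winIndBlindCanSup F PartInfo s A = ∑ o : Challenge (F.n s) → Bool,
      open Classical in
      if Differs o then 0 else if NoHonestSupported o then 0 else
        expect (PMF.uniformOfFintype (Bits (F.n s)))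
          (guessProb PartInfo A o (A.A₁.run A.advice noMsg o)) := by
  refine Finset.sum_congr rfl fun o _ => ?_
  split_ifs with h1 h2
  · rfl
  · rfl
  · have hinner : ∀ (c : Bool) (kt : Bits (F.lK s) × Bits (F.lT s))
        (yb : Fin (F.lY s) ⊕ Fin (F.lX s) → Bool) (v : Fin (F.n s) → Info),
        (expect (phaseDist F s kt.1 (fun i => yb (.inl i)) (fun i => yb (.inr i)) v) fun α =>
          expect (PMF.uniformOfFinset (shares (support o c) α) (shares_nonempty _ _)) fun r =>
          weight (A.A₃.run (A.A₂.run (A.A₁.run A.advice noMsg o) kt.1 yb)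
            (canMsg (corrupted o) r v) fun _ => c)) =
        expect (PMF.uniformOfFintype (Bits (F.n s))) fun r =>
          weight (A.A₃.run (A.A₂.run (A.A₁.run A.advice noMsg o) kt.1 yb)
            (canMsg (corrupted o) r v) fun _ => c) := by
      intro c kt yb v
      have := fun α => expect_shares_canMsg h1 h2 c α v fun m =>
        weight (A.A₃.run (A.A₂.run (A.A₁.run A.advice noMsg o) kt.1 yb) m fun _ => c)
      simp only [this, expect_const]
    simp only [hinner]
    have hcomm : ∀ {α : Type} [Fintype α] (μ : PMF α) (g : α → Bits (F.n s) → ℝ),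
        expect μ (fun a => expect (PMF.uniformOfFintype (Bits (F.n s))) (g a)) =
          expect (PMF.uniformOfFintype (Bits (F.n s))) fun r => expect μ fun a => g a r :=
      fun μ g => expect_comm μ _ g
    simp only [hcomm, ← expect_sum]
    rfl

/-- Some first message and some shares make the reduction at least as successful as `A`, unless `A`
wins with probability at most `1 / 2`. -/
theorem exists_partialAdversary (PartInfo : F.PartInfoAlg) (A : BlindAdversary F s) :
    ∃ B : PartialAdversary F s, B.size ≤ 4 * F.n s + A.size ∧
      winIndBlindCanSup F PartInfo s A ≤ max (1 / 2) (winIndPartial F PartInfo s B) := by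
  classical
  set ρ : (Challenge (F.n s) → Bool) → Op A.q₁ := fun o => A.A₁.run A.advice noMsg o with hρ
  have hpos : ∀ o, (ρ o).PosSemidef := fun o => A.A₁.run_posSemidef A.advice_pos _ _
  have hnonneg : ∀ o, 0 ≤ weight (ρ o) := fun o => (Complex.le_def.mp (hpos o).trace_nonneg).1
  have htrace : ∀ o, (ρ o).trace = (weight (ρ o) : ℂ) := fun o =>
    Complex.ext rfl (Complex.le_def.mp (hpos o).trace_nonneg).2.symm
  have hsum : ∑ o, weight (ρ o) = 1 := by
    simp only [weight, ← Complex.re_sum, hρ]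
    rw [A.A₁.sum_trace_run, A.advice_trace, Complex.one_re]
  -- The state of `A` after the first message `o`, normalized if `o` is possible at all.
  have hstate : ∀ o, weight (ρ o) ≠ 0 → ∃ σ : Op A.q₁, σ.PosSemidef ∧ σ.trace = 1 ∧
      ρ o = ((weight (ρ o) : ℝ) : ℂ) • σ := by
    intro o ho
    have ho' : ((weight (ρ o) : ℝ) : ℂ) ≠ 0 := Complex.ofReal_ne_zero.mpr ho
    refine ⟨(((weight (ρ o))⁻¹ : ℝ) : ℂ) • ρ o, ?_, ?_, ?_⟩
    · exact (hpos o).smul (Complex.zero_le_real.mpr (inv_nonneg.mpr (hnonneg o)))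
    · rw [Matrix.trace_smul, htrace, smul_eq_mul, Complex.ofReal_inv, inv_mul_cancel₀ ho']
    · rw [smul_smul, Complex.ofReal_inv, mul_inv_cancel₀ ho', one_smul]
  obtain ⟨o₀, ho₀⟩ : ∃ o, weight (ρ o) ≠ 0 := by
    by_contra! h
    rw [Finset.sum_eq_zero fun o _ => h o] at hsum
    exact zero_ne_one hsum
  have hB : ∀ p : (Challenge (F.n s) → Bool) × Bits (F.n s), ∃ B : PartialAdversary F s,
      B.size ≤ 4 * F.n s + A.size ∧ (¬ Differs p.1 →
        guessProb PartInfo A p.1 (ρ p.1) p.2 = winIndPartial F PartInfo s B * weight (ρ p.1)) := by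
    rintro ⟨o, r⟩
    -- For a first message that never occurs, any reduction will do.
    by_cases ho : weight (ρ o) = 0
    · obtain ⟨σ, hσ, hσ', -⟩ := hstate o₀ ho₀
      refine ⟨reduction A σ hσ hσ' o₀ r, size_reduction_le A σ hσ hσ' o₀ r, fun _ => ?_⟩
      -- A positive semidefinite operator of trace zero vanishes.
      have hzero : ρ o = ((0 : ℝ) : ℂ) • ρ o := by
        have : ρ o = 0 := (hpos o).trace_eq_zero_iff.mp (by rw [htrace, ho, Complex.ofReal_zero])
        rw [this, smul_zero]
      simp only
      rw [ho, mul_zero, hzero, guessProb_smul, mul_zero]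
    · obtain ⟨σ, hσ, hσ', h⟩ := hstate o ho
      refine ⟨reduction A σ hσ hσ' o fun i => decide (i ∈ corrupted o) && r i,
        size_reduction_le A σ hσ hσ' o _, fun hd => ?_⟩
      rw [winIndPartial_reduction PartInfo A hσ hσ' hd r, ← guessProb_smul, ← h]
  choose B hBsize hBwin using hB
  obtain ⟨p, hp⟩ := Finite.exists_max fun p => winIndPartial F PartInfo s (B p)
  refine ⟨B p, hBsize p, ?_⟩
  set β := max (1 / 2) (winIndPartial F PartInfo s (B p)) with hβ
  have hβ0 : 0 ≤ β := le_max_of_le_left (by norm_num)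
  rw [winIndBlindCanSup_eq, ← mul_one β, ← hsum, Finset.mul_sum]
  refine Finset.sum_le_sum fun o _ => ?_
  split_ifs with h1 h2
  · exact mul_nonneg hβ0 (hnonneg o)
  · exact mul_nonneg hβ0 (hnonneg o)
  · refine expect_le _ fun r => ?_
    rw [hBwin (o, r) h1]
    exact mul_le_mul_of_nonneg_right ((hp (o, r)).trans (le_max_right _ _)) (hnonneg o)

end Games

/-! ### Asymptotics -/

theorem Negligible.abs {ν : ℕ → ℝ} (h : Negligible ν) : Negligible fun s => |ν s| := by
  intro c
  simpa [abs_mul] using (h c).abs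

theorem PolyBounded.linear_add {g g' : ℕ → ℕ} (h : PolyBounded g) (h' : PolyBounded g') (c : ℕ) :
    PolyBounded fun s => c * g s + g' s := by
  obtain ⟨p, hp⟩ := h
  obtain ⟨p', hp'⟩ := h'
  refine ⟨Polynomial.C c * p + p', fun s => ?_⟩
  rw [Polynomial.eval_add, Polynomial.eval_mul, Polynomial.eval_C]
  exact add_le_add (Nat.mul_le_mul_left c (hp s)) (hp' s)

theorem PolyBounded.mono {g g' : ℕ → ℕ} (h : PolyBounded g) (hle : ∀ s, g' s ≤ g s) :
    PolyBounded g' := by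
  obtain ⟨p, hp⟩ := h
  exact ⟨p, fun s => (hle s).trans (hp s)⟩

end BlindGHZ

theorem mainTheorem7 (F : BlindGHZ.Family) (PartInfo : F.PartInfoAlg) (δ : ℕ → ℝ)
    (hδ : BlindGHZ.Negligible δ) (hF : BlindGHZ.IsGHZCanCapable F PartInfo δ)
    (A : ∀ s, BlindGHZ.BlindAdversary F s)
    (hA : BlindGHZ.PolyBounded fun s => (A s).size) :
    ∃ ν : ℕ → ℝ, BlindGHZ.Negligible ν ∧
      ∀ s, BlindGHZ.winIndBlindCanSup F PartInfo s (A s) ≤ 1 / 2 + ν s := by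
  choose B hsize hwin using fun s => BlindGHZ.exists_partialAdversary PartInfo (A s)
  obtain ⟨ν, hν, hB⟩ := hF.ind_partial B ((hF.poly_n.linear_add hA 4).mono hsize)
  refine ⟨fun s => |ν s|, hν.abs, fun s => (hwin s).trans (max_le ?_ ?_)⟩
  · exact le_add_of_nonneg_right (abs_nonneg _)
  · exact (hB s).trans (add_le_add_right (le_abs_self _) _)
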